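/- Let $k,n\ge 2$ be integers and let $\mathcal M^k_{kn}$ be the set of perfect hypermatchings of the complete $k$-uniform hypergraph on $[kn]$, i.e. the set of partitions $m$ of $[kn]$ into $n$ blocks (edges) of size $k$. The symmetric group $S_{kn}$ acts on $\mathcal M^k_{kn}$ and hence on the space $\mathbb R[\mathcal M^k_{kn}]$ of real functions on it, by $(gf)(m)=f(g^{-1}m)$; this space carries its standard inner product. Let $V_1$ be the $(kn-2,2)$-isotypic component of $\mathbb R[\mathcal M^k_{kn}]$, that is, the sum of all subrepresentations isomorphic to the Specht module of shape $(kn-2,2)$, and let $E_1$ be the orthogonal projection onto $V_1$. For $m,m'\in\mathcal M^k_{kn}$ put $$\mathrm{fp}_{2/k}(m,m')=\sum_{e\in m}\sum_{e'\in m'}\binom{|e\cap e'|}{2}.$$ (a) Let $m_0\in\mathcal M^k_{kn}$ and let $H\le S_{kn}$ be its stabilizer. There is exactly one bi-$H$-invariant function $\omega:S_{kn}\to\mathbb R$ with $\omega(1)=1$ that has the form $\omega(g)=f(g\,m_0)$ for some $f\in V_1$ (the $(kn-2,2)$-spherical function), and for all $g\in S_{kn}$ $$\omega(g)=\frac{2(kn-1)}{k^2(k-1)n(n-1)}\,\mathrm{fp}_{2/k}(m_0,g\,m_0)-\frac{k-1}{k(n-1)}.$$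 (b) For all $m,m'\in\mathcal M^k_{kn}$, the matrix entry of $E_1$ is $$(E_1)_{m,m'}=\frac{(kn-1)(kn-3)}{k(k-1)(n-1)\,|\mathcal M^k_{kn}|}\,\mathrm{fp}_{2/k}(m,m')-\frac{k-1}{|\mathcal M^k_{kn}|\,k(n-1)}\left(\binom{kn}{2}-kn\right).$$ (c) For all $\mathcal F\subseteq\mathcal M^k_{kn}$ and $m\in\mathcal M^k_{kn}$, $$(E_1 1_{\mathcal F})_m=\frac{(kn-1)(kn-3)}{k(k-1)(n-1)\,|\mathcal M^k_{kn}|}\sum_{ij\subseteq e\in m}|\mathcal F{\downarrow_{ij}}|-\frac{|\mathcal F|\,(k-1)}{|\mathcal M^k_{kn}|\,k(n-1)}\left(\binom{kn}{2}-kn\right),$$ where $1_{\mathcal F}$ is the characteristic vector of $\mathcal F$, the sum runs over all 2-subsets $ij$ of edges $e$ of $m$, and $\mathcal F{\downarrow_{ij}}=\{m'\in\mathcal F: ij\subseteq e'\text{ for some }e'\in m'\}$. -/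

import Mathlib

open scoped Pointwise MonoidAlgebra

noncomputable section

namespace Hypermatching

/-- A perfect hypermatching of the complete `k`-uniform hypergraph on `k * n` vertices:
a set of `k`-subsets (the edges) such that each vertex lies in exactly one of them. -/
def PerfectHypermatching (k n : ℕ) : Type :=
  {m : Finset (Finset (Fin (k * n))) //
    (∀ e ∈ m, e.card = k) ∧ ∀ x : Fin (k * n), ∃! e, e ∈ m ∧ x ∈ e}

namespace PerfectHypermatching

variable {k n : ℕ}

instance : DecidableEq (PerfectHypermatching k n) :=
  inferInstanceAs (DecidableEq {m : Finset (Finset (Fin (k * n))) //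
    (∀ e ∈ m, e.card = k) ∧ ∀ x : Fin (k * n), ∃! e, e ∈ m ∧ x ∈ e})

instance : Finite (PerfectHypermatching k n) :=
  inferInstanceAs (Finite {m : Finset (Finset (Fin (k * n))) //
    (∀ e ∈ m, e.card = k) ∧ ∀ x : Fin (k * n), ∃! e, e ∈ m ∧ x ∈ e})

instance : Fintype (PerfectHypermatching k n) := Fintype.ofFinite _

/-- The set of edges of a perfect hypermatching. -/
def edges (m : PerfectHypermatching k n) : Finset (Finset (Fin (k * n))) := m.1

/-- The symmetric group on the vertices acts on perfect hypermatchings by moving the vertices of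
every edge. -/
instance : MulAction (Equiv.Perm (Fin (k * n))) (PerfectHypermatching k n) where
  smul g m := ⟨g • m.1, by
    obtain ⟨m, hc, hu⟩ := m
    refine ⟨?_, ?_⟩
    · intro e he
      obtain ⟨e', he', rfl⟩ := Finset.mem_smul_finset.1 he
      rw [Finset.card_smul_finset]
      exact hc e' he'
    · intro x
      obtain ⟨e, ⟨he, hx⟩, huniq⟩ := hu (g⁻¹ • x)
      refine ⟨g • e, ⟨Finset.smul_mem_smul_finset he, ?_⟩, ?_⟩
      · exact Finset.inv_smul_mem_iff.1 hx
      · rintro e' ⟨he', hx'⟩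
        have h := huniq (g⁻¹ • e') ⟨Finset.inv_smul_mem_iff.2 he', ?_⟩
        · rw [← h, smul_inv_smul]
        · exact Finset.smul_mem_smul_finset hx'⟩
  one_smul m := Subtype.ext (one_smul _ m.1)
  mul_smul g h m := Subtype.ext (mul_smul g h m.1)

end PerfectHypermatching

/-- The linear action of `G` on the space of real functions on a finite `G`-set `X`, namely
`(g f)(x) = f (g⁻¹ x)`. The space carries the standard inner product `∑ x, f x * f' x`. -/
def permRep (G X : Type*) [Group G] [MulAction G X] [Fintype X] :
    Representation ℝ G (EuclideanSpace ℝ X) where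
  toFun g :=
    { toFun := fun f => WithLp.toLp 2 fun x => f (g⁻¹ • x)
      map_add' := fun _ _ => rfl
      map_smul' := fun _ _ => rfl }
  map_one' := by
    ext f x
    simp
  map_mul' g h := by
    ext f x
    change f ((g * h)⁻¹ • x) = f (h⁻¹ • g⁻¹ • x)
    rw [mul_inv_rev, mul_smul]

/-- The basis vector of the permutation module `M^(N-2,2)` given by the tabloid with second row
`{c, d}` (for `c ≠ d`). A tabloid of shape `(N-2,2)` is identified with the 2-subset in its
second row. -/
def tabloidVec {N : ℕ} (c d : Fin N) : EuclideanSpace ℝ (Set.powersetCard (Fin N) 2) :=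
  WithLp.toLp 2 fun p => if (p : Finset (Fin N)) = {c, d} then 1 else 0

/-- The polytabloid of a tableau of shape `(N-2,2)` with first row `a, b, …` and second row `c, d`:
the column stabilizer is generated by the transpositions `(a c)` and `(b d)`. -/
def polytabloid {N : ℕ} (a b c d : Fin N) : EuclideanSpace ℝ (Set.powersetCard (Fin N) 2) :=
  tabloidVec c d - tabloidVec a d - tabloidVec c b + tabloidVec a b

theorem permRep_tabloidVec {N : ℕ} (g : Equiv.Perm (Fin N)) (c d : Fin N) :
    permRep (Equiv.Perm (Fin N)) (Set.powersetCard (Fin N) 2) g (tabloidVec c d) =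
      tabloidVec (g c) (g d) := by
  ext p
  have h : ((g⁻¹ • p : Set.powersetCard (Fin N) 2) : Finset (Fin N)) = {c, d} ↔
      (p : Finset (Fin N)) = {g c, g d} := by
    rw [Set.powersetCard.coe_smul, inv_smul_eq_iff]
    simp [Finset.smul_finset_insert, Finset.smul_finset_singleton]
  change (if ((g⁻¹ • p : Set.powersetCard (Fin N) 2) : Finset (Fin N)) = {c, d} then (1 : ℝ) else 0) =
    if (p : Finset (Fin N)) = {g c, g d} then 1 else 0
  simp only [h]

/-- The Specht module of shape `(N-2,2)` over `ℝ`, spanned by all polytabloids of that shape inside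
the permutation module `M^(N-2,2)`. -/
def specht (N : ℕ) :
    Subrepresentation (permRep (Equiv.Perm (Fin N)) (Set.powersetCard (Fin N) 2)) where
  toSubmodule := Submodule.span ℝ
    {v | ∃ a b c d : Fin N, [a, b, c, d].Nodup ∧ v = polytabloid a b c d}
  apply_mem_toSubmodule g v hv := by
    induction hv using Submodule.span_induction with
    | mem v hv =>
      obtain ⟨a, b, c, d, hd, rfl⟩ := hv
      refine Submodule.subset_span ⟨g a, g b, g c, g d, ?_, ?_⟩
      · simpa using hd.map g.injective
      · simp [polytabloid, permRep_tabloidVec]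
    | zero => simp
    | add x y _ _ hx hy =>
      rw [map_add]
      exact Submodule.add_mem _ hx hy
    | smul r x _ hx =>
      rw [map_smul]
      exact Submodule.smul_mem _ r hx

variable {k n : ℕ}

/-- The `(kn-2,2)`-isotypic component of the space of real functions on the perfect
hypermatchings. -/
def isotypic (k n : ℕ) : Submodule ℝ (EuclideanSpace ℝ (PerfectHypermatching k n)) :=
  (Subrepresentation.ofSubmodule'
    (isotypicComponent ℝ[Equiv.Perm (Fin (k * n))]
      (permRep (Equiv.Perm (Fin (k * n))) (PerfectHypermatching k n)).asModule
      (specht (k * n)).toRepresentation.asModule)).toSubmodule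

/-- The orthogonal projection onto the `(kn-2,2)`-isotypic component. -/
def E₁ (k n : ℕ) : EuclideanSpace ℝ (PerfectHypermatching k n) →L[ℝ]
    EuclideanSpace ℝ (PerfectHypermatching k n) :=
  (isotypic k n).starProjection

/-- The characteristic vector of a family of perfect hypermatchings. -/
def charVec (F : Finset (PerfectHypermatching k n)) :
    EuclideanSpace ℝ (PerfectHypermatching k n) :=
  WithLp.toLp 2 fun m => if m ∈ F then 1 else 0

/-- The members of `F` having an edge that contains the set `p`. -/
def restriction (F : Finset (PerfectHypermatching k n)) (p : Finset (Fin (k * n))) :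
    Finset (PerfectHypermatching k n) :=
  {m ∈ F | ∃ e ∈ m.edges, p ⊆ e}

/-- The sum of `binom(|e ∩ e'|, 2)` over all entries `|e ∩ e'|` of the meet table of `m` and `m'`,
where `e` runs over the edges of `m` and `e'` over the edges of `m'`. -/
def fp (m m' : PerfectHypermatching k n) : ℕ :=
  ∑ e ∈ m.edges, ∑ e' ∈ m'.edges, (e ∩ e').card.choose 2

/-- `ω` is a `(kn-2,2)`-spherical function with respect to the stabilizer `H` of `m₀`: it is
bi-`H`-invariant, has value `1` at the identity, and, viewed as a function on the perfect
hypermatchings (the orbit of `m₀`), lies in the `(kn-2,2)`-isotypic component. -/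
def IsSpherical (m₀ : PerfectHypermatching k n) (ω : Equiv.Perm (Fin (k * n)) → ℝ) : Prop :=
  (∀ h ∈ MulAction.stabilizer (Equiv.Perm (Fin (k * n))) m₀,
    ∀ h' ∈ MulAction.stabilizer (Equiv.Perm (Fin (k * n))) m₀,
      ∀ g, ω (h * g * h') = ω g) ∧
  ω 1 = 1 ∧
  ∃ f ∈ isotypic k n, ∀ g, ω g = f (g • m₀)

end Hypermatching

end

/-! Write `1_m` for the indicator of the 2-subsets lying in edges of `m`, and let `T` (`edgeSum`)
send a function `s` on 2-subsets to `m ↦ ⟪1_m, s⟫`. This map is equivariant, and `fp m m' = ⟪1_m,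
1_m'⟫`. The Specht module `S` is exactly the space of pair functions with zero row sums.

Two facts carry the proof. First, `⟪T v, T s⟫ = λ ⟪v, s⟫` for `s ∈ S`: the number of matchings
joining `a, b` and joining `x, y` depends only on the overlap of the two pairs, so it is a constant,
plus a multiple of the overlap, plus `λ` times the equality indicator, and zero row sums kill all
but the last term. As `λ > 0`, `T` is injective on `S`. Second, the stabilizer `H` of `m` has two
orbits on pairs, and the row-sum condition leaves one line of `H`-fixed vectors in `S`, spanned by
`c_m`, which is `1_m` minus a constant.

By Riesz and Frobenius reciprocity every intertwiner from `S` to functions on matchings is a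
multiple of `T`, so `V₁ = T(S)`. Hence `E₁ δ_m = λ⁻¹ T c_m`, and the spherical function is `T c_m₀`
normalised at `m₀`; both are affine in `fp`. Part (c) is (b) summed over the family. -/

namespace Hypermatching

/-! ### Functions on 2-subsets; the Specht module as the zero row-sum space. -/

section PairFunctions

variable {N : ℕ}

theorem inner_permRep {G X : Type*} [Group G] [MulAction G X] [Fintype X] (g : G)
    (s t : EuclideanSpace ℝ X) : inner ℝ (permRep G X g s) (permRep G X g t) = inner ℝ s t := by
  simp only [PiLp.inner_apply]
  exact Equiv.sum_comp (MulAction.toPerm (g⁻¹ : G)) (fun x => inner ℝ (s x) (t x))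

theorem permRep_apply {G X : Type*} [Group G] [MulAction G X] [Fintype X] (g : G)
    (s : EuclideanSpace ℝ X) (x : X) : permRep G X g s x = s (g⁻¹ • x) := rfl

theorem tabloidVec_comm (a b : Fin N) : tabloidVec a b = tabloidVec b a := by
  unfold tabloidVec
  rw [Finset.pair_comm]

theorem tabloidVec_self (a : Fin N) : tabloidVec a a = 0 := by
  ext p
  have h : (p : Finset (Fin N)) ≠ {a, a} := fun h => by
    have := p.2
    rw [Set.powersetCard.mem_iff, h] at this
    simp at this
  exact if_neg h

/-- The value of a function on 2-subsets at the pair `{a, b}`, which is `0` if `a = b`. -/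
noncomputable def pairVal (s : EuclideanSpace ℝ (Set.powersetCard (Fin N) 2)) (a b : Fin N) : ℝ :=
  inner ℝ (tabloidVec a b) s

theorem pairVal_eq_sum (s : EuclideanSpace ℝ (Set.powersetCard (Fin N) 2)) (a b : Fin N) :
    pairVal s a b = ∑ p : Set.powersetCard (Fin N) 2,
      if (p : Finset (Fin N)) = {a, b} then s p else 0 := by
  simp [pairVal, PiLp.inner_apply, tabloidVec]

theorem pairVal_comm (s : EuclideanSpace ℝ (Set.powersetCard (Fin N) 2)) (a b : Fin N) :
    pairVal s a b = pairVal s b a := by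
  rw [pairVal, tabloidVec_comm, pairVal]

theorem pairVal_self (s : EuclideanSpace ℝ (Set.powersetCard (Fin N) 2)) (a : Fin N) :
    pairVal s a a = 0 := by
  rw [pairVal, tabloidVec_self, inner_zero_left]

theorem pairVal_add (s t : EuclideanSpace ℝ (Set.powersetCard (Fin N) 2)) (a b : Fin N) :
    pairVal (s + t) a b = pairVal s a b + pairVal t a b := inner_add_right _ _ _

theorem pairVal_sub (s t : EuclideanSpace ℝ (Set.powersetCard (Fin N) 2)) (a b : Fin N) :
    pairVal (s - t) a b = pairVal s a b - pairVal t a b := inner_sub_right _ _ _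

theorem pairVal_smul (r : ℝ) (s : EuclideanSpace ℝ (Set.powersetCard (Fin N) 2)) (a b : Fin N) :
    pairVal (r • s) a b = r * pairVal s a b := real_inner_smul_right _ _ _

theorem pairVal_of_ne (s : EuclideanSpace ℝ (Set.powersetCard (Fin N) 2)) {a b : Fin N}
    (p : Set.powersetCard (Fin N) 2) (h : (p : Finset (Fin N)) = {a, b}) :
    pairVal s a b = s p := by
  rw [pairVal_eq_sum, Finset.sum_eq_single p]
  · rw [if_pos h]
  · intro q _ hq
    rw [if_neg]
    exact fun h' => hq (Subtype.ext (h'.trans h.symm))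
  · simp

theorem exists_pair (p : Set.powersetCard (Fin N) 2) :
    ∃ a b, a ≠ b ∧ (p : Finset (Fin N)) = {a, b} :=
  Finset.card_eq_two.1 (Set.powersetCard.mem_iff.1 p.2)

theorem pairVal_ext {s t : EuclideanSpace ℝ (Set.powersetCard (Fin N) 2)}
    (h : ∀ a b, a ≠ b → pairVal s a b = pairVal t a b) : s = t := by
  ext p
  obtain ⟨a, b, hab, hp⟩ := exists_pair p
  rw [← pairVal_of_ne s p hp, ← pairVal_of_ne t p hp, h a b hab]

theorem pairVal_permRep (g : Equiv.Perm (Fin N))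
    (s : EuclideanSpace ℝ (Set.powersetCard (Fin N) 2)) (a b : Fin N) :
    pairVal (permRep (Equiv.Perm (Fin N)) _ g s) (g a) (g b) = pairVal s a b := by
  rw [pairVal, ← permRep_tabloidVec, inner_permRep, pairVal]

/-- Each 2-subset arises from two ordered pairs, and the diagonal contributes nothing by the
convention `pairVal s a a = 0`. -/
theorem inner_eq_half_sum (s t : EuclideanSpace ℝ (Set.powersetCard (Fin N) 2)) :
    inner ℝ s t = (1 / 2) * ∑ a, ∑ b, pairVal s a b * pairVal t a b := by
  have h1 : ∀ a b, pairVal s a b * pairVal t a b =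
      ∑ p : Set.powersetCard (Fin N) 2, if (p : Finset (Fin N)) = {a, b} then s p * t p else 0 := by
    intro a b
    by_cases hab : a = b
    · subst hab
      rw [pairVal_self, zero_mul, Finset.sum_eq_zero]
      intro p _
      rw [if_neg]
      intro h
      have := Set.powersetCard.mem_iff.1 p.2
      rw [h] at this
      simp at this
    · have hc : ({a, b} : Finset (Fin N)).card = 2 := Finset.card_pair hab
      let p : Set.powersetCard (Fin N) 2 := ⟨{a, b}, hc⟩
      rw [pairVal_of_ne s p rfl, pairVal_of_ne t p rfl, Finset.sum_eq_single p]
      · rw [if_pos rfl]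
      · intro q _ hq
        rw [if_neg]
        exact fun h' => hq (Subtype.ext h')
      · simp
  have h2 : ∀ p : Set.powersetCard (Fin N) 2,
      ∑ a, ∑ b, (if (p : Finset (Fin N)) = {a, b} then s p * t p else 0) = 2 * (s p * t p) := by
    intro p
    obtain ⟨c, d, hcd, hp⟩ := exists_pair p
    have h3 : ∀ x : Fin N × Fin N, ((p : Finset (Fin N)) = {x.1, x.2}) ↔
        x ∈ ({(c, d), (d, c)} : Finset (Fin N × Fin N)) := by
      rintro ⟨x, y⟩
      rw [hp]
      simp only [Finset.mem_insert, Finset.mem_singleton, Prod.mk.injEq]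
      constructor
      · intro h
        have hx : x ∈ ({c, d} : Finset (Fin N)) := by rw [h]; simp
        have hy : y ∈ ({c, d} : Finset (Fin N)) := by rw [h]; simp
        have hc : c ∈ ({x, y} : Finset (Fin N)) := by rw [← h]; simp
        have hd : d ∈ ({x, y} : Finset (Fin N)) := by rw [← h]; simp
        simp only [Finset.mem_insert, Finset.mem_singleton] at hx hy hc hd
        grind
      · rintro (⟨rfl, rfl⟩ | ⟨rfl, rfl⟩)
        · rfl
        · exact Finset.pair_comm _ _
    rw [← Fintype.sum_prod_type' (fun a b => if (p : Finset (Fin N)) = {a, b} then s p * t p else 0)]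
    simp only [h3]
    rw [Finset.sum_ite_mem, Finset.univ_inter, Finset.sum_pair]
    · ring
    · simp [hcd]
  simp only [h1]
  rw [Finset.sum_congr rfl fun a _ => Finset.sum_comm, Finset.sum_comm]
  simp only [h2, PiLp.inner_apply, ← Finset.mul_sum]
  rw [← mul_assoc]
  norm_num
  exact Finset.sum_congr rfl fun _ _ => mul_comm _ _

theorem pairVal_tabloidVec (a b : Fin N) {c d : Fin N} (hcd : c ≠ d) :
    pairVal (tabloidVec a b) c d = if ({c, d} : Finset (Fin N)) = {a, b} then 1 else 0 := by
  have hc : ({c, d} : Finset (Fin N)).card = 2 := Finset.card_pair hcd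
  rw [pairVal_of_ne _ (⟨{c, d}, hc⟩ : Set.powersetCard (Fin N) 2) rfl]
  rfl

theorem pairVal_tabloidVec' {a b : Fin N} (hab : a ≠ b) (c d : Fin N) :
    pairVal (tabloidVec a b) c d =
      (if c = a then if d = b then 1 else 0 else 0) + if c = b then if d = a then 1 else 0 else 0 := by
  by_cases hcd : c = d
  · subst hcd
    rw [pairVal_self]
    grind
  · have : pairVal (tabloidVec a b) c d = pairVal (tabloidVec c d) a b := real_inner_comm _ _
    rw [pairVal_tabloidVec _ _ hcd]
    have h : ({c, d} : Finset (Fin N)) = {a, b} ↔ (c = a ∧ d = b) ∨ (c = b ∧ d = a) := by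
      rw [← Finset.coe_inj]
      push_cast
      exact Set.pair_eq_pair_iff
    simp only [h]
    grind

/-- A polytabloid is a 4-cycle with alternating signs, so each of its vertices meets one positive
and one negative pair. -/
theorem sum_pairVal_eq_zero {s : EuclideanSpace ℝ (Set.powersetCard (Fin N) 2)}
    (hs : s ∈ (specht N).toSubmodule) (x : Fin N) : ∑ y, pairVal s x y = 0 := by
  change s ∈ Submodule.span ℝ _ at hs
  induction hs using Submodule.span_induction with
  | mem v hv =>
    obtain ⟨a, b, c, d, hd, rfl⟩ := hv
    simp only [List.nodup_cons, List.mem_cons, not_or, List.not_mem_nil] at hd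
    obtain ⟨⟨hab, hac, had, -⟩, ⟨hbc, hbd, -⟩, ⟨hcd, -⟩, -⟩ := hd
    simp only [polytabloid, pairVal_add, pairVal_sub, pairVal_tabloidVec' hcd,
      pairVal_tabloidVec' had, pairVal_tabloidVec' (Ne.symm hbc), pairVal_tabloidVec' hab,
      Finset.sum_add_distrib, Finset.sum_sub_distrib]
    have h : ∀ u v : Fin N, ∑ y, (if x = u then if y = v then (1 : ℝ) else 0 else 0) =
        if x = u then 1 else 0 := by
      intro u v
      split_ifs <;> simp
    simp only [h]
    ring
  | zero => simp [pairVal]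
  | add s t _ _ hs ht => simp only [pairVal_add, Finset.sum_add_distrib, hs, ht, add_zero]
  | smul r s _ hs => simp only [pairVal_smul, ← Finset.mul_sum, hs, mul_zero]

/-- A symmetric function of pairs satisfying the four-point identities is additive. -/
theorem exists_add_of_four_point (hN : 4 ≤ N) (f : Fin N → Fin N → ℝ) (hf : ∀ a b, f a b = f b a)
    (h4 : ∀ a b c d : Fin N, [a, b, c, d].Nodup → f a b + f c d = f a d + f c b) :
    ∃ u : Fin N → ℝ, ∀ a b, a ≠ b → f a b = u a + u b := by
  -- If `f` is additive, this combination equals `2 * u a`; so it must not depend on the other two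
  -- vertices. Here one of them is replaced, then both.
  have key : ∀ a b c d : Fin N, a ≠ b → a ≠ c → b ≠ c → a ≠ d → b ≠ d →
      f a b + f a c - f b c = f a b + f a d - f b d := by
    intro a b c d hab hac hbc had hbd
    by_cases hcd : c = d
    · rw [hcd]
    · have := h4 a c b d (by simp; grind)
      linarith [hf a b, hf c b, hf b c]
  have key' : ∀ a b c b' c' : Fin N, a ≠ b → a ≠ c → b ≠ c → a ≠ b' → a ≠ c' → b' ≠ c' →
      f a b + f a c - f b c = f a b' + f a c' - f b' c' := by
    intro a b c b' c' hab hac hbc hab' hac' hbc'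
    by_cases h : b = c'
    · subst h
      linarith [key a b c b' hab hac hbc hab' (Ne.symm hbc'), hf b b']
    · linarith [key a b c c' hab hac hbc hac' h,
        key a c' b b' hac' hab (Ne.symm h) hab' (Ne.symm hbc'), hf b c', hf b' c']
  have hex : ∀ a : Fin N, ∃ b c, a ≠ b ∧ a ≠ c ∧ b ≠ c := by
    intro a
    have : 1 < ({a}ᶜ : Finset (Fin N)).card := by
      rw [Finset.card_compl, Fintype.card_fin, Finset.card_singleton]
      omega
    obtain ⟨b, hb, c, hc, hbc⟩ := Finset.one_lt_card.1 this
    simp only [Finset.mem_compl, Finset.mem_singleton] at hb hc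
    exact ⟨b, c, Ne.symm hb, Ne.symm hc, hbc⟩
  choose B C hB hC hBC using hex
  refine ⟨fun a => (f a (B a) + f a (C a) - f (B a) (C a)) / 2, fun a b hab => ?_⟩
  have : 0 < ({a, b}ᶜ : Finset (Fin N)).card := by
    rw [Finset.card_compl, Fintype.card_fin, Finset.card_pair hab]
    omega
  obtain ⟨c, hc⟩ := Finset.card_pos.1 this
  simp only [Finset.mem_compl, Finset.mem_singleton, Finset.mem_insert, not_or] at hc
  -- Computing `u a` and `u b` on the same triangle `a, b, c` makes the terms through `c` cancel.
  have h1 := key' a (B a) (C a) b c (hB a) (hC a) (hBC a) hab (Ne.symm hc.1) (Ne.symm hc.2)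
  have h2 := key' b (B b) (C b) a c (hB b) (hC b) (hBC b) (Ne.symm hab) (Ne.symm hc.2)
    (Ne.symm hc.1)
  simp only [h1, h2]
  linarith [hf a b]

/-- By double orthogonality: a function orthogonal to all polytabloids satisfies the four-point
identities, hence has the form `u a + u b`, and such functions are orthogonal to everything with
zero row sums. -/
theorem mem_specht_of_sum_eq_zero (hN : 4 ≤ N)
    {s : EuclideanSpace ℝ (Set.powersetCard (Fin N) 2)} (hs : ∀ x, ∑ y, pairVal s x y = 0) :
    s ∈ (specht N).toSubmodule := by
  rw [← Submodule.orthogonal_orthogonal (specht N).toSubmodule, Submodule.mem_orthogonal]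
  intro f hf
  obtain ⟨u, hu⟩ := exists_add_of_four_point hN (pairVal f) (pairVal_comm f) (by
    intro a b c d hd
    have h := (Submodule.mem_orthogonal _ _).1 hf (polytabloid a b c d)
      (Submodule.subset_span ⟨a, b, c, d, hd, rfl⟩)
    simp only [polytabloid, inner_add_left, inner_sub_left] at h
    simp only [pairVal]
    linarith)
  have h : ∀ a b, pairVal f a b * pairVal s a b = u a * pairVal s a b + u b * pairVal s b a := by
    intro a b
    by_cases hab : a = b
    · simp [hab, pairVal_self]
    · rw [hu a b hab, pairVal_comm s b a]
      ring
  rw [inner_eq_half_sum]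
  simp only [h, Finset.sum_add_distrib, ← Finset.mul_sum, hs]
  rw [Finset.sum_comm]
  simp only [← Finset.mul_sum, hs]
  simp

end PairFunctions

/-! ### Matchings as equivalence relations, and their pair indicators. -/

section Matchings

variable {k n : ℕ}

theorem card_of_mem_edges {m : PerfectHypermatching k n} {e : Finset (Fin (k * n))}
    (he : e ∈ m.edges) : e.card = k := m.2.1 e he

theorem exists_mem_edges (m : PerfectHypermatching k n) (x : Fin (k * n)) :
    ∃ e ∈ m.edges, x ∈ e := by
  obtain ⟨e, he, -⟩ := m.2.2 x
  exact ⟨e, he.1, he.2⟩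

theorem edges_unique {m : PerfectHypermatching k n} {x : Fin (k * n)} {e e' : Finset (Fin (k * n))}
    (he : e ∈ m.edges) (hx : x ∈ e) (hf : e' ∈ m.edges) (hy : x ∈ e') : e = e' :=
  (m.2.2 x).unique ⟨he, hx⟩ ⟨hf, hy⟩

/-- Two vertices lie in a common edge. -/
def SameEdge (m : PerfectHypermatching k n) (x y : Fin (k * n)) : Prop :=
  ∃ e ∈ m.edges, x ∈ e ∧ y ∈ e

noncomputable instance (m : PerfectHypermatching k n) (x y : Fin (k * n)) :
    Decidable (SameEdge m x y) := Classical.propDecidable _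

theorem SameEdge.refl (m : PerfectHypermatching k n) (x : Fin (k * n)) : SameEdge m x x := by
  obtain ⟨e, he, hx⟩ := exists_mem_edges m x
  exact ⟨e, he, hx, hx⟩

theorem SameEdge.symm {m : PerfectHypermatching k n} {x y : Fin (k * n)} (h : SameEdge m x y) :
    SameEdge m y x := by
  obtain ⟨e, he, hx, hy⟩ := h
  exact ⟨e, he, hy, hx⟩

theorem sameEdge_comm {m : PerfectHypermatching k n} {x y : Fin (k * n)} :
    SameEdge m x y ↔ SameEdge m y x := ⟨SameEdge.symm, SameEdge.symm⟩

theorem SameEdge.trans {m : PerfectHypermatching k n} {x y z : Fin (k * n)} (h : SameEdge m x y)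
    (h' : SameEdge m y z) : SameEdge m x z := by
  obtain ⟨e, he, hx, hy⟩ := h
  obtain ⟨e', he', hy', hz⟩ := h'
  obtain rfl := edges_unique he hy he' hy'
  exact ⟨e, he, hx, hz⟩

theorem mem_iff_sameEdge {m : PerfectHypermatching k n} {x y : Fin (k * n)}
    {e : Finset (Fin (k * n))} (he : e ∈ m.edges) (hx : x ∈ e) : y ∈ e ↔ SameEdge m x y := by
  constructor
  · exact fun hy => ⟨e, he, hx, hy⟩
  · rintro ⟨e', he', hx', hy'⟩
    rwa [edges_unique he hx he' hx']

theorem card_sameEdge (m : PerfectHypermatching k n) (x : Fin (k * n)) :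
    (Finset.univ.filter (SameEdge m x)).card = k := by
  obtain ⟨e, he, hx⟩ := exists_mem_edges m x
  refine Eq.trans (congrArg Finset.card ?_) (card_of_mem_edges he)
  ext y
  simp [mem_iff_sameEdge he hx]

theorem sum_sameEdge (m : PerfectHypermatching k n) (x : Fin (k * n)) :
    ∑ y, (if SameEdge m x y then (1 : ℝ) else 0) = k := by
  rw [Finset.sum_boole, card_sameEdge]

theorem smul_edges (g : Equiv.Perm (Fin (k * n))) (m : PerfectHypermatching k n) :
    (g • m).edges = g • m.edges := rfl

theorem sameEdge_smul (g : Equiv.Perm (Fin (k * n))) (m : PerfectHypermatching k n)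
    (x y : Fin (k * n)) : SameEdge (g • m) (g x) (g y) ↔ SameEdge m x y := by
  constructor
  · rintro ⟨e, he, hx, hy⟩
    rw [smul_edges] at he
    obtain ⟨e', he', rfl⟩ := Finset.mem_smul_finset.1 he
    exact ⟨e', he', (Finset.smul_mem_smul_finset_iff g).1 hx,
      (Finset.smul_mem_smul_finset_iff g).1 hy⟩
  · rintro ⟨e, he, hx, hy⟩
    exact ⟨g • e, Finset.smul_mem_smul_finset he, Finset.smul_mem_smul_finset hx,
      Finset.smul_mem_smul_finset hy⟩

/-- Edges are nonempty because `0 < k`, so each is the class of any of its vertices. -/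
theorem edges_subset_of_sameEdge (hk : 0 < k) {m m' : PerfectHypermatching k n}
    (h : ∀ x y, SameEdge m x y ↔ SameEdge m' x y) : m.edges ⊆ m'.edges := by
  intro e he
  have hc := card_of_mem_edges he
  obtain ⟨x, hx⟩ := Finset.card_pos.1 (hc ▸ hk)
  obtain ⟨e', he', hx'⟩ := exists_mem_edges m' x
  have : e = e' := by
    ext y
    rw [mem_iff_sameEdge he hx, mem_iff_sameEdge he' hx', h]
  rwa [this]

theorem eq_of_sameEdge (hk : 0 < k) {m m' : PerfectHypermatching k n}
    (h : ∀ x y, SameEdge m x y ↔ SameEdge m' x y) : m = m' :=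
  Subtype.ext ((edges_subset_of_sameEdge hk h).antisymm
    (edges_subset_of_sameEdge hk fun x y => (h x y).symm))

theorem smul_eq_of_sameEdge (hk : 0 < k) {m m' : PerfectHypermatching k n}
    {g : Equiv.Perm (Fin (k * n))} (h : ∀ x y, SameEdge m' (g x) (g y) ↔ SameEdge m x y) :
    g • m = m' := by
  refine eq_of_sameEdge hk fun x y => ?_
  obtain ⟨x, rfl⟩ := g.surjective x
  obtain ⟨y, rfl⟩ := g.surjective y
  rw [sameEdge_smul, h]

open Classical in
/-- The indicator function of the 2-subsets contained in an edge of `m`. -/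
noncomputable def pairIndicator (m : PerfectHypermatching k n) :
    EuclideanSpace ℝ (Set.powersetCard (Fin (k * n)) 2) :=
  WithLp.toLp 2 fun p => if ∃ e ∈ m.edges, (p : Finset (Fin (k * n))) ⊆ e then 1 else 0

theorem pairVal_pairIndicator (m : PerfectHypermatching k n) {a b : Fin (k * n)} (hab : a ≠ b) :
    pairVal (pairIndicator m) a b = if SameEdge m a b then 1 else 0 := by
  have hc : ({a, b} : Finset (Fin (k * n))).card = 2 := Finset.card_pair hab
  rw [pairVal_of_ne _ (⟨{a, b}, hc⟩ : Set.powersetCard (Fin (k * n)) 2) rfl]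
  change (if ∃ e ∈ m.edges, ({a, b} : Finset (Fin (k * n))) ⊆ e then (1 : ℝ) else 0) = _
  have : (∃ e ∈ m.edges, ({a, b} : Finset (Fin (k * n))) ⊆ e) ↔ SameEdge m a b := by
    simp [SameEdge, Finset.insert_subset_iff]
  simp only [this]

theorem pairVal_pairIndicator_mul (m : PerfectHypermatching k n)
    (s : EuclideanSpace ℝ (Set.powersetCard (Fin (k * n)) 2)) (a b : Fin (k * n)) :
    pairVal (pairIndicator m) a b * pairVal s a b = (if SameEdge m a b then 1 else 0) *
      pairVal s a b := by
  by_cases hab : a = b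
  · simp [hab, pairVal_self]
  · rw [pairVal_pairIndicator m hab]

theorem inner_pairIndicator (m : PerfectHypermatching k n)
    (s : EuclideanSpace ℝ (Set.powersetCard (Fin (k * n)) 2)) :
    inner ℝ (pairIndicator m) s =
      (1 / 2) * ∑ a, ∑ b, (if SameEdge m a b then 1 else 0) * pairVal s a b := by
  rw [inner_eq_half_sum]
  simp only [pairVal_pairIndicator_mul]

theorem permRep_pairIndicator (g : Equiv.Perm (Fin (k * n))) (m : PerfectHypermatching k n) :
    permRep _ _ g (pairIndicator m) = pairIndicator (g • m) := by
  refine pairVal_ext fun a b hab => ?_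
  obtain ⟨a, rfl⟩ := g.surjective a
  obtain ⟨b, rfl⟩ := g.surjective b
  have hab' : a ≠ b := fun h => hab (congrArg g h)
  rw [pairVal_permRep, pairVal_pairIndicator _ hab, pairVal_pairIndicator _ hab']
  simp only [sameEdge_smul]

/-- The binomial counts 2-subsets of `e` inside `e'`; a nonempty set lies in at most one edge of
`m'`, so the sum over `e'` collapses to an indicator. -/
theorem sum_edges_choose (m m' : PerfectHypermatching k n) :
    fp m m' = ∑ e ∈ m.edges, ∑ p ∈ e.powersetCard 2, if ∃ e' ∈ m'.edges, p ⊆ e' then 1 else 0 := by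
  unfold fp
  refine Finset.sum_congr rfl fun e _ => ?_
  have h1 : ∀ e' : Finset (Fin (k * n)),
      (e ∩ e').card.choose 2 = ∑ p ∈ e.powersetCard 2, if p ⊆ e' then 1 else 0 := by
    intro e'
    rw [← Finset.card_powersetCard, ← Finset.sum_filter, Finset.sum_const, smul_eq_mul, mul_one]
    congr 1
    ext p
    simp only [Finset.mem_powersetCard, Finset.mem_filter, Finset.subset_inter_iff]
    tauto
  simp only [h1]
  rw [Finset.sum_comm]
  refine Finset.sum_congr rfl fun p hp => ?_
  obtain ⟨x, hx⟩ := Finset.card_pos.1 ((Finset.mem_powersetCard.1 hp).2 ▸ two_pos)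
  split_ifs with h
  · obtain ⟨e', he', hp'⟩ := h
    rw [Finset.sum_eq_single e', if_pos hp']
    · intro e'' he'' hne
      rw [if_neg]
      exact fun h => hne (edges_unique he'' (h hx) he' (hp' hx))
    · exact fun h => absurd he' h
  · push Not at h
    exact Finset.sum_eq_zero fun e' he' => if_neg (h e' he')

theorem inner_pairIndicator_pairIndicator (m m' : PerfectHypermatching k n) :
    inner ℝ (pairIndicator m) (pairIndicator m') = (fp m m' : ℝ) := by
  classical
  have h1 : ∀ p : Set.powersetCard (Fin (k * n)) 2,
      (if ∃ e ∈ m.edges, (p : Finset (Fin (k * n))) ⊆ e then (1 : ℝ) else 0) =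
        ∑ e ∈ m.edges, if (p : Finset (Fin (k * n))) ⊆ e then 1 else 0 := by
    intro p
    obtain ⟨x, y, -, hp⟩ := exists_pair p
    split_ifs with h
    · obtain ⟨e', he', hp'⟩ := h
      rw [Finset.sum_eq_single e', if_pos hp']
      · intro e'' he'' hne
        rw [if_neg]
        have hx : x ∈ (p : Finset (Fin (k * n))) := by rw [hp]; simp
        exact fun h => hne (edges_unique he'' (h hx) he' (hp' hx))
      · exact fun h => absurd he' h
    · push Not at h
      exact (Finset.sum_eq_zero fun e' he' => if_neg (h e' he')).symm
  have h2 : inner ℝ (pairIndicator m) (pairIndicator m') =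
      ∑ p : Set.powersetCard (Fin (k * n)) 2,
        (if ∃ e ∈ m.edges, (p : Finset (Fin (k * n))) ⊆ e then (1 : ℝ) else 0) *
          (if ∃ e ∈ m'.edges, (p : Finset (Fin (k * n))) ⊆ e then (1 : ℝ) else 0) := by
    simp only [PiLp.inner_apply, pairIndicator]
    exact Finset.sum_congr rfl fun p _ => mul_comm _ _
  have h4 := fun p : Set.powersetCard (Fin (k * n)) 2 => congrArg
    (· * if ∃ e ∈ m'.edges, (p : Finset (Fin (k * n))) ⊆ e then (1 : ℝ) else 0) (h1 p)
  simp only [Finset.sum_mul] at h4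
  rw [h2, sum_edges_choose, Finset.sum_congr rfl fun p _ => h4 p, Finset.sum_comm]
  push_cast
  refine Finset.sum_congr rfl fun e _ => ?_
  have h3 : ∀ q : Finset (Fin (k * n)),
      q ∈ Finset.powersetCard 2 (Finset.univ : Finset (Fin (k * n))) ↔ q ∈ Set.powersetCard (Fin (k * n)) 2 := by
    intro q
    simp [Finset.mem_powersetCard, Set.powersetCard.mem_iff]
  rw [← Finset.sum_subtype (Finset.powersetCard 2 (Finset.univ : Finset (Fin (k * n)))) h3
    (fun p => (if p ⊆ e then (1 : ℝ) else 0) * if ∃ e ∈ m'.edges, p ⊆ e then (1 : ℝ) else 0)]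
  simp only [ite_mul, one_mul, zero_mul]
  rw [← Finset.sum_filter]
  refine Finset.sum_congr ?_ fun p _ => by congr
  ext p
  simp only [Finset.mem_powersetCard, Finset.mem_filter, Finset.subset_univ, true_and]
  tauto

end Matchings

/-! ### Counting matchings that join two given pairs. -/

section Coincidences

variable {k n : ℕ}

/-- The number of matchings in which `a`, `b` share an edge and `x`, `y` share an edge. -/
noncomputable def coincidences (k n : ℕ) (a b x y : Fin (k * n)) : ℝ :=
  ∑ m : PerfectHypermatching k n,
    (if SameEdge m a b then 1 else 0) * (if SameEdge m x y then 1 else 0)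

theorem coincidences_perm (g : Equiv.Perm (Fin (k * n))) (a b x y : Fin (k * n)) :
    coincidences k n (g a) (g b) (g x) (g y) = coincidences k n a b x y := by
  unfold coincidences
  rw [← Equiv.sum_comp (MulAction.toPerm g)]
  simp only [MulAction.toPerm_apply, sameEdge_smul]

theorem coincidences_swap_right (a b x y : Fin (k * n)) :
    coincidences k n a b y x = coincidences k n a b x y := by
  simp only [coincidences, sameEdge_comm (x := x)]

theorem coincidences_swap_left (a b x y : Fin (k * n)) :
    coincidences k n b a x y = coincidences k n a b x y := by
  simp only [coincidences, sameEdge_comm (x := a)]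

theorem coincidences_eq_of_iff {a b x y a' b' x' y' : Fin (k * n)}
    (h : ∀ m : PerfectHypermatching k n,
      (SameEdge m a b ∧ SameEdge m x y) ↔ (SameEdge m a' b' ∧ SameEdge m x' y')) :
    coincidences k n a b x y = coincidences k n a' b' x' y' := by
  unfold coincidences
  congr 1
  ext m
  have := h m
  split_ifs <;> simp <;> tauto

/-- In each matching, `x` shares its edge with exactly `k` vertices, itself included. -/
theorem sum_coincidences (a b x : Fin (k * n)) :
    ∑ y, coincidences k n a b x y = k * coincidences k n a b a b := by
  unfold coincidences
  rw [Finset.sum_comm]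
  simp only [← Finset.mul_sum, sum_sameEdge]
  rw [Finset.mul_sum]
  refine Finset.sum_congr rfl fun m _ => ?_
  split_ifs <;> simp

theorem coincidences_eq_of_notMem {a b x y y' : Fin (k * n)} (hy : y ∉ ({a, b, x} : Finset _))
    (hy' : y' ∉ ({a, b, x} : Finset _)) :
    coincidences k n a b x y = coincidences k n a b x y' := by
  simp only [Finset.mem_insert, Finset.mem_singleton, not_or] at hy hy'
  have := coincidences_perm (Equiv.swap y y') a b x y
  rw [Equiv.swap_apply_left, Equiv.swap_apply_of_ne_of_ne (Ne.symm hy.1) (Ne.symm hy'.1),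
    Equiv.swap_apply_of_ne_of_ne (Ne.symm hy.2.1) (Ne.symm hy'.2.1),
    Equiv.swap_apply_of_ne_of_ne (Ne.symm hy.2.2) (Ne.symm hy'.2.2)] at this
  exact this.symm

theorem sum_add_card_mul {ι : Type*} [Fintype ι] [DecidableEq ι] (T : Finset ι) (f : ι → ℝ) (c : ℝ)
    (h : ∀ i ∉ T, f i = c) : ∑ i, f i = ∑ i ∈ T, f i + (Fintype.card ι - T.card) * c := by
  rw [← Finset.sum_add_sum_compl T f, Finset.sum_congr (s₁ := Tᶜ) rfl
    fun i hi => h i (Finset.mem_compl.1 hi), Finset.sum_const, Finset.card_compl, nsmul_eq_mul,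
    Nat.cast_sub (Finset.card_le_univ T)]

/-- All `y` outside `{a, b, x}` give the same count, so the sum over `y` determines it. The points
may coincide, hence the unevaluated cardinality; degenerate choices give the recursion for overlaps
2, 1 and 0. -/
theorem coincidences_relation (a b x y : Fin (k * n)) (hy : y ∉ ({a, b, x} : Finset _)) :
    ∑ z ∈ ({a, b, x} : Finset _), coincidences k n a b x z +
      (k * n - ({a, b, x} : Finset (Fin (k * n))).card) * coincidences k n a b x y =
        k * coincidences k n a b a b := by
  rw [← sum_coincidences a b x, sum_add_card_mul {a, b, x} (coincidences k n a b x)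
    (coincidences k n a b x y) fun z hz => coincidences_eq_of_notMem hz hy]
  simp

theorem coincidences_two {a b : Fin (k * n)} (hab : a ≠ b) :
    ((k : ℝ) * n - 1) * coincidences k n a b a b =
      Fintype.card (PerfectHypermatching k n) * (k - 1) := by
  have h := coincidences_relation a a a b (by simpa using Ne.symm hab)
  have h1 : coincidences k n a a a a = Fintype.card (PerfectHypermatching k n) := by
    simp [coincidences, SameEdge.refl]
  have h2 : coincidences k n a a a b = coincidences k n a b a b :=
    coincidences_eq_of_iff fun m => by simp [SameEdge.refl]
  simp only [Finset.mem_singleton, Finset.insert_eq_of_mem, Finset.sum_singleton,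
    Finset.card_singleton, h1, h2] at h
  push_cast at h
  linarith

theorem coincidences_three {a b x : Fin (k * n)} (hab : a ≠ b) (hax : a ≠ x) (hbx : b ≠ x) :
    ((k : ℝ) * n - 2) * coincidences k n a b a x = (k - 2) * coincidences k n a b a b := by
  have h := coincidences_relation a b a x (by simp; grind)
  have h2 : coincidences k n a b a a = coincidences k n a b a b :=
    coincidences_eq_of_iff fun m => by simp [SameEdge.refl]
  have h3 : ({a, b, a} : Finset (Fin (k * n))) = {a, b} := by ext; simp; tauto
  rw [h3, Finset.sum_pair hab, Finset.card_pair hab, h2] at h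
  push_cast at h
  linarith

theorem coincidences_three' {a b x : Fin (k * n)} (hab : a ≠ b) (hax : a ≠ x) (hbx : b ≠ x) :
    ((k : ℝ) * n - 2) * coincidences k n a b b x = (k - 2) * coincidences k n a b a b := by
  have h := coincidences_three (Ne.symm hab) hbx hax
  rwa [coincidences_swap_left a b b x, coincidences_swap_left a b b a,
    coincidences_swap_right a b a b] at h

theorem coincidences_four {a b x y : Fin (k * n)} (hab : a ≠ b) (hax : a ≠ x) (hbx : b ≠ x)
    (hay : a ≠ y) (hby : b ≠ y) (hxy : x ≠ y) :
    ((k : ℝ) * n - 3) * coincidences k n a b x y + 2 * coincidences k n a b a x =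
      (k - 1) * coincidences k n a b a b := by
  have h := coincidences_relation a b x y (by simp; grind)
  have h2 : coincidences k n a b x x = coincidences k n a b a b :=
    coincidences_eq_of_iff fun m => by simp [SameEdge.refl]
  have h3 : coincidences k n a b x b = coincidences k n a b x a :=
    coincidences_eq_of_iff fun m => ⟨fun h => ⟨h.1, h.2.trans h.1.symm⟩,
      fun h => ⟨h.1, h.2.trans h.1⟩⟩
  rw [Finset.sum_insert (by simp; grind), Finset.sum_pair hbx, Finset.card_insert_of_notMem
    (by simp; grind), Finset.card_pair hbx, h2, h3, coincidences_swap_right] at h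
  push_cast at h
  linarith

end Coincidences

/-! ### The Gram operator acts on the Specht module as a scalar. -/

section Eigenvalue

variable {k n : ℕ}

/-- The eigenvalue of the Gram operator of the pair indicators on the Specht module. -/
noncomputable def gramEigenvalue (k n : ℕ) : ℝ :=
  Fintype.card (PerfectHypermatching k n) * (k - 1) * (k * n - k) / ((k * n - 1) * (k * n - 3))

theorem four_le_mul (hk : 2 ≤ k) (hn : 2 ≤ n) : (4 : ℝ) ≤ k * n := by
  exact_mod_cast Nat.mul_le_mul hk hn

/-- The bracketing separates a term in `x` alone and a term in `y` alone, both annihilated by zero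
row sums. -/
theorem coincidences_eq (hk : 2 ≤ k) (hn : 2 ≤ n) :
    ∃ α β : ℝ, ∀ a b x y : Fin (k * n), a ≠ b → x ≠ y →
      coincidences k n a b x y = (α + β * ((if x = a then 1 else 0) + if x = b then 1 else 0)) +
        β * ((if y = a then 1 else 0) + if y = b then 1 else 0) +
        gramEigenvalue k n * ((if x = a then if y = b then 1 else 0 else 0) +
          if x = b then if y = a then 1 else 0 else 0) := by
  have hN := four_le_mul hk hn
  have hN1 : (k : ℝ) * n - 1 ≠ 0 := by linarith
  have hN2 : (k : ℝ) * n - 2 ≠ 0 := by linarith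
  have hN3 : (k : ℝ) * n - 3 ≠ 0 := by linarith
  obtain ⟨c, hc⟩ : ∃ c : ℝ, c = Fintype.card (PerfectHypermatching k n) := ⟨_, rfl⟩
  obtain ⟨α₂, h2⟩ : ∃ α₂ : ℝ, α₂ = c * (k - 1) / (k * n - 1) := ⟨_, rfl⟩
  obtain ⟨α₁, h1⟩ : ∃ α₁ : ℝ, α₁ = (k - 2) * α₂ / (k * n - 2) := ⟨_, rfl⟩
  obtain ⟨α₀, h0⟩ : ∃ α₀ : ℝ, α₀ = ((k - 1) * α₂ - 2 * α₁) / (k * n - 3) := ⟨_, rfl⟩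
  -- With `α₂, α₁, α₀` the counts for overlap 2, 1, 0, the coefficient of the equality indicator is
  -- their second difference.
  have hlam : gramEigenvalue k n = α₂ - 2 * α₁ + α₀ := by
    rw [h0, h1, h2, gramEigenvalue, ← hc]
    field_simp
    ring
  have e2 : ∀ a b : Fin (k * n), a ≠ b → coincidences k n a b a b = α₂ := by
    intro a b hab
    rw [h2, eq_div_iff hN1, hc, ← coincidences_two hab, mul_comm]
  have e1 : ∀ a b x : Fin (k * n), a ≠ b → a ≠ x → b ≠ x → coincidences k n a b a x = α₁ := by
    intro a b x hab hax hbx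
    rw [h1, eq_div_iff hN2, ← e2 a b hab, ← coincidences_three hab hax hbx, mul_comm]
  have e1' : ∀ a b x : Fin (k * n), a ≠ b → a ≠ x → b ≠ x → coincidences k n a b b x = α₁ := by
    intro a b x hab hax hbx
    rw [h1, eq_div_iff hN2, ← e2 a b hab, ← coincidences_three' hab hax hbx, mul_comm]
  have e0 : ∀ a b x y : Fin (k * n), a ≠ b → a ≠ x → b ≠ x → a ≠ y → b ≠ y → x ≠ y →
      coincidences k n a b x y = α₀ := by
    intro a b x y hab hax hbx hay hby hxy
    rw [h0, eq_div_iff hN3, ← e2 a b hab, ← e1 a b x hab hax hbx,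
      ← coincidences_four hab hax hbx hay hby hxy]
    ring
  refine ⟨α₀, α₁ - α₀, fun a b x y hab hxy => ?_⟩
  rw [hlam]
  by_cases hxa : x = a
  · subst hxa
    by_cases hyb : y = b
    · subst hyb
      rw [e2 _ _ hab]
      simp only [if_pos, if_neg hab, if_neg (Ne.symm hab)]
      ring
    · rw [e1 _ _ _ hab hxy (Ne.symm hyb)]
      simp only [if_pos, if_neg hab, if_neg hyb, if_neg (Ne.symm hxy)]
      ring
  · by_cases hxb : x = b
    · subst hxb
      by_cases hya : y = a
      · subst hya
        rw [coincidences_swap_right, e2 _ _ hab]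
        simp only [if_pos, if_neg hab, if_neg (Ne.symm hab)]
        ring
      · rw [e1' _ _ _ hab (Ne.symm hya) hxy]
        simp only [if_pos, if_neg (Ne.symm hab), if_neg hya, if_neg (Ne.symm hxy)]
        ring
    · by_cases hya : y = a
      · subst hya
        rw [coincidences_swap_right, e1 _ _ _ hab (Ne.symm hxa) (Ne.symm hxb)]
        simp only [if_pos, if_neg hab, if_neg hxa, if_neg hxb]
        ring
      · by_cases hyb : y = b
        · subst hyb
          rw [coincidences_swap_right, e1' _ _ _ hab (Ne.symm hxa) (Ne.symm hxb)]
          simp only [if_pos, if_neg (Ne.symm hab), if_neg hxa, if_neg hxb]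
          ring
        · rw [e0 _ _ _ _ hab (Ne.symm hxa) (Ne.symm hxb) (Ne.symm hya) (Ne.symm hyb) hxy]
          simp only [if_neg hya, if_neg hyb, if_neg hxa, if_neg hxb]
          ring

theorem sum_sameEdge_mul_inner (hk : 2 ≤ k) (hn : 2 ≤ n)
    {s : EuclideanSpace ℝ (Set.powersetCard (Fin (k * n)) 2)}
    (hs : s ∈ (specht (k * n)).toSubmodule) {a b : Fin (k * n)} (hab : a ≠ b) :
    ∑ m : PerfectHypermatching k n, (if SameEdge m a b then 1 else 0) *
      inner ℝ (pairIndicator m) s = gramEigenvalue k n * pairVal s a b := by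
  obtain ⟨α, β, h⟩ := coincidences_eq hk hn
  have hr := sum_pairVal_eq_zero hs
  have hc : ∀ y, ∑ x, pairVal s x y = 0 := fun y => by
    simp only [fun x => pairVal_comm s x y, hr]
  have h1 : ∑ m : PerfectHypermatching k n, (if SameEdge m a b then 1 else 0) *
      inner ℝ (pairIndicator m) s =
        (1 / 2) * ∑ x, ∑ y, coincidences k n a b x y * pairVal s x y := by
    simp only [inner_pairIndicator, coincidences, Finset.mul_sum, Finset.sum_mul]
    rw [Finset.sum_comm]
    refine Finset.sum_congr rfl fun x _ => ?_
    rw [Finset.sum_comm]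
    refine Finset.sum_congr rfl fun y _ => Finset.sum_congr rfl fun m _ => ?_
    ring
  have h2 : ∀ x y, coincidences k n a b x y * pairVal s x y =
      ((α + β * ((if x = a then 1 else 0) + if x = b then 1 else 0)) +
        β * ((if y = a then 1 else 0) + if y = b then 1 else 0) +
        gramEigenvalue k n * ((if x = a then if y = b then 1 else 0 else 0) +
          if x = b then if y = a then 1 else 0 else 0)) * pairVal s x y := by
    intro x y
    by_cases hxy : x = y
    · simp [hxy, pairVal_self]
    · rw [h a b x y hab hxy]
  have h3 : ∀ f : Fin (k * n) → ℝ, ∑ x, ∑ y, f x * pairVal s x y = 0 := fun f => by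
    simp only [← Finset.mul_sum, hr, mul_zero, Finset.sum_const_zero]
  have h4 : ∀ f : Fin (k * n) → ℝ, ∑ x, ∑ y, f y * pairVal s x y = 0 := fun f => by
    rw [Finset.sum_comm]
    simp only [← Finset.mul_sum, hc, mul_zero, Finset.sum_const_zero]
  have h5 : ∀ u v : Fin (k * n),
      ∑ x, ∑ y, (if x = u then if y = v then 1 else 0 else 0) * pairVal s x y = pairVal s u v := by
    intro u v
    rw [Finset.sum_eq_single u, Finset.sum_eq_single v]
    · simp
    · intro y _ hy
      simp [hy]
    · simp
    · intro x _ hx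
      simp [hx]
    · simp
  have h6 : ∀ (f g : Fin (k * n) → ℝ) (w : Fin (k * n) → Fin (k * n) → ℝ),
      ∑ x, ∑ y, (f x + g y + w x y) * pairVal s x y = ∑ x, ∑ y, w x y * pairVal s x y := by
    intro f g w
    simp only [add_mul, Finset.sum_add_distrib, h3, h4, zero_add]
  rw [h1]
  simp only [h2]
  rw [h6 (fun x => α + β * ((if x = a then 1 else 0) + if x = b then 1 else 0))
    (fun y => β * ((if y = a then 1 else 0) + if y = b then 1 else 0))
    (fun x y => gramEigenvalue k n * ((if x = a then if y = b then 1 else 0 else 0) +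
      if x = b then if y = a then 1 else 0 else 0))]
  simp only [mul_assoc, ← Finset.mul_sum, add_mul, Finset.sum_add_distrib, h5,
    pairVal_comm s b a]
  ring

theorem sum_inner_mul_inner (hk : 2 ≤ k) (hn : 2 ≤ n)
    (v : EuclideanSpace ℝ (Set.powersetCard (Fin (k * n)) 2))
    {s : EuclideanSpace ℝ (Set.powersetCard (Fin (k * n)) 2)}
    (hs : s ∈ (specht (k * n)).toSubmodule) :
    ∑ m : PerfectHypermatching k n, inner ℝ (pairIndicator m) v * inner ℝ (pairIndicator m) s =
      gramEigenvalue k n * inner ℝ v s := by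
  have h1 : ∀ a b, pairVal v a b * ∑ m : PerfectHypermatching k n,
      (if SameEdge m a b then 1 else 0) * inner ℝ (pairIndicator m) s =
      gramEigenvalue k n * (pairVal v a b * pairVal s a b) := by
    intro a b
    by_cases hab : a = b
    · simp [hab, pairVal_self]
    · rw [sum_sameEdge_mul_inner hk hn hs hab]
      ring
  rw [inner_eq_half_sum, mul_left_comm, Finset.mul_sum]
  simp only [Finset.mul_sum (a := gramEigenvalue k n), ← h1]
  simp only [inner_pairIndicator _ v, Finset.mul_sum, Finset.sum_mul]
  rw [Finset.sum_comm]
  refine Finset.sum_congr rfl fun a _ => ?_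
  rw [Finset.sum_comm]
  refine Finset.sum_congr rfl fun b _ => Finset.sum_congr rfl fun m _ => ?_
  ring

end Eigenvalue

/-! ### Block coordinates and the stabilizer's orbits on pairs. -/

section Coordinates

variable {k n : ℕ}

/-- The map from vertices to edges has all fibres of size `k`; comparing cardinalities then shows
that there are `n` edges. -/
theorem exists_coordinates (hk : 0 < k) (m : PerfectHypermatching k n) :
    ∃ φ : Fin (k * n) ≃ Fin n × Fin k, ∀ x y, SameEdge m x y ↔ (φ x).1 = (φ y).1 := by
  classical
  choose B hB hxB using exists_mem_edges m
  let β : Fin (k * n) → m.edges := fun x => ⟨B x, hB x⟩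
  have hmem : ∀ x y, y ∈ B x ↔ β x = β y := by
    intro x y
    constructor
    · exact fun h => Subtype.ext (edges_unique (hB x) h (hB y) (hxB y))
    · intro h
      have : B x = B y := congrArg Subtype.val h
      exact this ▸ hxB y
  have hcard : ∀ e : m.edges, Fintype.card {x // β x = e} = Fintype.card (Fin k) := by
    intro e
    rw [Fintype.card_fin, Fintype.card_subtype]
    refine Eq.trans (congrArg Finset.card ?_) (card_of_mem_edges e.2)
    ext x
    simp only [Finset.mem_filter, Finset.mem_univ, true_and]
    constructor
    · rintro h
      rw [← h]
      exact hxB x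
    · exact fun h => Subtype.ext (edges_unique (hB x) (hxB x) e.2 h)
  let ψ : Fin (k * n) ≃ m.edges × Fin k := (Equiv.sigmaFiberEquiv β).symm.trans
    (Equiv.sigmaEquivProdOfEquiv fun e => Fintype.equivOfCardEq (hcard e))
  have hψ : ∀ x, (ψ x).1 = β x := fun x => rfl
  have hn : Fintype.card m.edges = Fintype.card (Fin n) := by
    have := Fintype.card_congr ψ
    rw [Fintype.card_fin, Fintype.card_prod, Fintype.card_fin] at this
    exact (Nat.eq_of_mul_eq_mul_right hk ((mul_comm n k).trans this)).symm.trans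
      (Fintype.card_fin n).symm
  refine ⟨ψ.trans (Equiv.prodCongr (Fintype.equivOfCardEq hn) (Equiv.refl _)), fun x y => ?_⟩
  rw [← mem_iff_sameEdge (hB x) (hxB x), hmem]
  simp [hψ]

theorem exists_smul_eq (hk : 0 < k) (m m' : PerfectHypermatching k n) :
    ∃ g : Equiv.Perm (Fin (k * n)), g • m = m' := by
  obtain ⟨φ, hφ⟩ := exists_coordinates hk m
  obtain ⟨ψ, hψ⟩ := exists_coordinates hk m'
  refine ⟨φ.trans ψ.symm, smul_eq_of_sameEdge hk fun x y => ?_⟩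
  rw [hφ, hψ]
  simp

theorem exists_perm_apply_two {α : Type*} [DecidableEq α] {a b a' b' : α} (hab : a ≠ b)
    (hab' : a' ≠ b') : ∃ σ : Equiv.Perm α, σ a = a' ∧ σ b = b' := by
  refine ⟨Equiv.swap (Equiv.swap a a' b) b' * Equiv.swap a a', ?_, ?_⟩
  · rw [Equiv.Perm.mul_apply, Equiv.swap_apply_left, Equiv.swap_apply_of_ne_of_ne _ hab']
    intro h
    have := congrArg (Equiv.swap a a') h
    simp only [Equiv.swap_apply_self, Equiv.swap_apply_right] at this
    exact hab this
  · simp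

/-- These are the wreath product elements: `σ` permutes the edges and `τ i` acts within the `i`-th
one. -/
theorem shear_mem_stabilizer (hk : 0 < k) {m : PerfectHypermatching k n}
    {φ : Fin (k * n) ≃ Fin n × Fin k} (hφ : ∀ x y, SameEdge m x y ↔ (φ x).1 = (φ y).1)
    (σ : Equiv.Perm (Fin n)) (τ : Fin n → Equiv.Perm (Fin k)) :
    (φ.trans ((Equiv.prodShear σ τ).trans φ.symm)) ∈
      MulAction.stabilizer (Equiv.Perm (Fin (k * n))) m := by
  refine MulAction.mem_stabilizer_iff.2 (smul_eq_of_sameEdge hk fun x y => ?_)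
  rw [hφ, hφ]
  simp [Equiv.prodShear]

theorem exists_stabilizer_of_sameEdge (hk : 0 < k) {m : PerfectHypermatching k n}
    {a b a' b' : Fin (k * n)} (hab : a ≠ b) (hab' : a' ≠ b') (h : SameEdge m a b)
    (h' : SameEdge m a' b') :
    ∃ g ∈ MulAction.stabilizer (Equiv.Perm (Fin (k * n))) m, g a = a' ∧ g b = b' := by
  obtain ⟨φ, hφ⟩ := exists_coordinates hk m
  have h1 := (hφ _ _).1 h
  have h1' := (hφ _ _).1 h'
  obtain ⟨τ, h2, h3⟩ := exists_perm_apply_two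
    (fun h => hab (φ.injective (Prod.ext h1 h))) (fun h => hab' (φ.injective (Prod.ext h1' h)))
  refine ⟨_, shear_mem_stabilizer hk hφ (Equiv.swap (φ a).1 (φ a').1) fun _ => τ, ?_, ?_⟩
  · simp [Equiv.prodShear, h2]
  · simp [Equiv.prodShear, h3, ← h1, h1']

/-- The two vertices lie in different edges, so the permutations within those edges can be chosen
independently. -/
theorem exists_stabilizer_of_not_sameEdge (hk : 0 < k) {m : PerfectHypermatching k n}
    {a b a' b' : Fin (k * n)} (h : ¬ SameEdge m a b) (h' : ¬ SameEdge m a' b') :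
    ∃ g ∈ MulAction.stabilizer (Equiv.Perm (Fin (k * n))) m, g a = a' ∧ g b = b' := by
  obtain ⟨φ, hφ⟩ := exists_coordinates hk m
  rw [hφ] at h h'
  obtain ⟨σ, h2, h3⟩ := exists_perm_apply_two h h'
  refine ⟨_, shear_mem_stabilizer hk hφ σ fun i => if i = (φ a).1
    then Equiv.swap (φ a).2 (φ a').2 else Equiv.swap (φ b).2 (φ b').2, ?_, ?_⟩
  · simp [Equiv.prodShear, h2]
  · simp [Equiv.prodShear, h3, Ne.symm h]

theorem exists_sameEdge_ne (hk : 2 ≤ k) (m : PerfectHypermatching k n) (a : Fin (k * n)) :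
    ∃ b, a ≠ b ∧ SameEdge m a b := by
  have h := card_sameEdge m a
  obtain ⟨b, hb, hne⟩ := Finset.exists_mem_ne (h ▸ hk : 1 < _) a
  exact ⟨b, Ne.symm hne, by simpa using hb⟩

theorem exists_not_sameEdge (hk : 2 ≤ k) (hn : 2 ≤ n) (m : PerfectHypermatching k n)
    (a : Fin (k * n)) : ∃ b, ¬ SameEdge m a b := by
  by_contra! h
  have hc := card_sameEdge m a
  rw [Finset.filter_true_of_mem fun x _ => h x, Finset.card_univ, Fintype.card_fin] at hc
  nlinarith

end Coordinates

/-! ### The stabilizer-fixed line in the Specht module. -/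

section SphericalVector

variable {k n : ℕ}

/-- The constant function `1` on 2-subsets. -/
noncomputable def allPairs (N : ℕ) : EuclideanSpace ℝ (Set.powersetCard (Fin N) 2) :=
  WithLp.toLp 2 fun _ => 1

theorem pairVal_allPairs {N : ℕ} (a b : Fin N) :
    pairVal (allPairs N) a b = 1 - if a = b then 1 else 0 := by
  by_cases hab : a = b
  · simp [hab, pairVal_self]
  · rw [pairVal_of_ne _ (⟨{a, b}, Finset.card_pair hab⟩ : Set.powersetCard (Fin N) 2) rfl]
    simp [allPairs, hab]

theorem pairVal_pairIndicator' (m : PerfectHypermatching k n) (a b : Fin (k * n)) :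
    pairVal (pairIndicator m) a b = (if SameEdge m a b then 1 else 0) - if a = b then 1 else 0 := by
  by_cases hab : a = b
  · subst hab
    simp [pairVal_self, SameEdge.refl]
  · simp [pairVal_pairIndicator m hab, hab]

/-- The projection of `pairIndicator m` to the Specht module. -/
noncomputable def centredIndicator (m : PerfectHypermatching k n) :
    EuclideanSpace ℝ (Set.powersetCard (Fin (k * n)) 2) :=
  pairIndicator m - (((k : ℝ) - 1) / (k * n - 1)) • allPairs (k * n)

/-- The row sums of `pairIndicator m` are `k - 1` and those of `allPairs` are `k * n - 1`. -/
theorem centredIndicator_mem (hk : 2 ≤ k) (hn : 2 ≤ n) (m : PerfectHypermatching k n) :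
    centredIndicator m ∈ (specht (k * n)).toSubmodule := by
  refine mem_specht_of_sum_eq_zero (Nat.mul_le_mul hk hn) fun x => ?_
  have hN := four_le_mul hk hn
  have hN1 : (k : ℝ) * n - 1 ≠ 0 := by linarith
  simp only [centredIndicator, pairVal_sub, pairVal_smul, pairVal_allPairs,
    pairVal_pairIndicator', Finset.sum_sub_distrib, ← Finset.mul_sum, sum_sameEdge]
  simp
  field_simp
  ring

theorem inner_allPairs_of_mem {N : ℕ} {s : EuclideanSpace ℝ (Set.powersetCard (Fin N) 2)}
    (hs : s ∈ (specht N).toSubmodule) : inner ℝ (allPairs N) s = 0 := by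
  have h : ∀ a b, pairVal (allPairs N) a b * pairVal s a b = pairVal s a b := by
    intro a b
    rw [pairVal_allPairs]
    by_cases hab : a = b
    · simp [hab, pairVal_self]
    · simp [hab]
  rw [inner_eq_half_sum]
  simp only [h, sum_pairVal_eq_zero hs, Finset.sum_const_zero, mul_zero]

theorem inner_centredIndicator (m : PerfectHypermatching k n)
    {s : EuclideanSpace ℝ (Set.powersetCard (Fin (k * n)) 2)}
    (hs : s ∈ (specht (k * n)).toSubmodule) :
    inner ℝ (centredIndicator m) s = inner ℝ (pairIndicator m) s := by
  rw [centredIndicator, inner_sub_left, real_inner_smul_left, inner_allPairs_of_mem hs]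
  ring

theorem inner_pairIndicator_allPairs (m : PerfectHypermatching k n) :
    inner ℝ (pairIndicator m) (allPairs (k * n)) = (k * n * (k - 1) / 2 : ℝ) := by
  have h : ∀ a b, (if SameEdge m a b then 1 else 0) * pairVal (allPairs (k * n)) a b =
      (if SameEdge m a b then 1 else 0) - if a = b then 1 else 0 := by
    intro a b
    rw [pairVal_allPairs]
    by_cases hab : a = b
    · simp [hab, SameEdge.refl]
    · simp [hab]
  rw [inner_pairIndicator]
  simp only [h, Finset.sum_sub_distrib, sum_sameEdge]
  simp
  ring

theorem inner_pairIndicator_centredIndicator (m m' : PerfectHypermatching k n) :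
    inner ℝ (pairIndicator m) (centredIndicator m') =
      fp m m' - ((k : ℝ) - 1) / (k * n - 1) * (k * n * (k - 1) / 2) := by
  rw [centredIndicator, inner_sub_right, real_inner_smul_right, inner_pairIndicator_pairIndicator,
    inner_pairIndicator_allPairs]

/-- A 0/1 function has the same inner product with itself as with the constant `1`. -/
theorem fp_self (m : PerfectHypermatching k n) : (fp m m : ℝ) = k * n * (k - 1) / 2 := by
  rw [← inner_pairIndicator_pairIndicator, ← inner_pairIndicator_allPairs m, inner_pairIndicator,
    inner_pairIndicator]
  congr 1
  refine Finset.sum_congr rfl fun a _ => Finset.sum_congr rfl fun b _ => ?_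
  rw [pairVal_pairIndicator', pairVal_allPairs]
  split_ifs <;> simp

theorem fp_comm (m m' : PerfectHypermatching k n) : fp m m' = fp m' m := by
  unfold fp
  rw [Finset.sum_comm]
  simp only [Finset.inter_comm]

theorem fp_smul_smul (g : Equiv.Perm (Fin (k * n))) (m m' : PerfectHypermatching k n) :
    fp (g • m) (g • m') = fp m m' := by
  have h : (fp (g • m) (g • m') : ℝ) = fp m m' := by
    rw [← inner_pairIndicator_pairIndicator, ← inner_pairIndicator_pairIndicator,
      ← permRep_pairIndicator, ← permRep_pairIndicator, inner_permRep]
  exact_mod_cast h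

/-- A vector of the Specht module fixed by the stabilizer of `m` is a multiple of the centred
indicator of `m`. -/
theorem eq_smul_centredIndicator (hk : 2 ≤ k) (hn : 2 ≤ n) (m : PerfectHypermatching k n)
    {s : EuclideanSpace ℝ (Set.powersetCard (Fin (k * n)) 2)}
    (hs : s ∈ (specht (k * n)).toSubmodule)
    (hfix : ∀ h ∈ MulAction.stabilizer (Equiv.Perm (Fin (k * n))) m, permRep _ _ h s = s) :
    ∃ t : ℝ, s = t • centredIndicator m := by
  have hN := four_le_mul hk hn
  have hN1 : (k : ℝ) * n - 1 ≠ 0 := by linarith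
  have hk0 : 0 < k := by omega
  have hinv : ∀ h ∈ MulAction.stabilizer (Equiv.Perm (Fin (k * n))) m, ∀ a b,
      pairVal s (h a) (h b) = pairVal s a b := by
    intro h hh a b
    have := pairVal_permRep h s a b
    rwa [hfix h hh] at this
  let x : Fin (k * n) := ⟨0, Nat.mul_pos hk0 (by omega)⟩
  obtain ⟨y, hxy, hy⟩ := exists_sameEdge_ne hk m x
  obtain ⟨z, hz⟩ := exists_not_sameEdge hk hn m x
  obtain ⟨α, hα⟩ : ∃ α, α = pairVal s x y := ⟨_, rfl⟩
  obtain ⟨β, hβ⟩ : ∃ β, β = pairVal s x z := ⟨_, rfl⟩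
  -- Two stabilizer orbits on ordered pairs of distinct vertices allow only two values.
  have hval : ∀ a b, a ≠ b → pairVal s a b = β + (α - β) * if SameEdge m a b then 1 else 0 := by
    intro a b hab
    split_ifs with h
    · obtain ⟨g, hg, rfl, rfl⟩ := exists_stabilizer_of_sameEdge hk0 hxy hab hy h
      rw [hinv g hg, ← hα]
      ring
    · obtain ⟨g, hg, rfl, rfl⟩ := exists_stabilizer_of_not_sameEdge hk0 hz h
      rw [hinv g hg, ← hβ]
      ring
  have hval' : ∀ a b, pairVal s a b = β * pairVal (allPairs (k * n)) a b +
      (α - β) * pairVal (pairIndicator m) a b := by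
    intro a b
    by_cases hab : a = b
    · simp [hab, pairVal_self]
    · rw [hval a b hab, pairVal_allPairs, pairVal_pairIndicator m hab, if_neg hab]
      ring
  -- One row sum gives `β * (k * n - 1) + (α - β) * (k - 1) = 0`, leaving a single free parameter.
  have hsum := sum_pairVal_eq_zero hs x
  simp only [hval', pairVal_allPairs, pairVal_pairIndicator', Finset.sum_add_distrib,
    ← Finset.mul_sum, Finset.sum_sub_distrib, sum_sameEdge] at hsum
  simp at hsum
  refine ⟨α - β, pairVal_ext fun a b _ => ?_⟩
  have hβ' : β = -((α - β) * (k - 1)) / (k * n - 1) := by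
    rw [eq_div_iff hN1]
    linarith
  rw [hval', pairVal_smul, centredIndicator, pairVal_sub, pairVal_smul]
  nth_rewrite 1 [hβ']
  ring

end SphericalVector

/-! ### The isotypic component, its projection and the spherical function. -/

section Isotypic

variable {k n : ℕ}

theorem permRep_symm_inner {G X : Type*} [Group G] [MulAction G X] [Fintype X] (g : G)
    (s t : EuclideanSpace ℝ X) : inner ℝ (permRep G X g s) t = inner ℝ s (permRep G X g⁻¹ t) := by
  rw [← inner_permRep g s, Representation.self_inv_apply]

/-- The map sending a function on 2-subsets to the function on matchings that sums its values over
all 2-subsets of edges. -/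
noncomputable def edgeSum (k n : ℕ) : EuclideanSpace ℝ (Set.powersetCard (Fin (k * n)) 2) →ₗ[ℝ]
    EuclideanSpace ℝ (PerfectHypermatching k n) where
  toFun s := WithLp.toLp 2 fun m => inner ℝ (pairIndicator m) s
  map_add' s t := by
    ext m
    exact inner_add_right _ _ _
  map_smul' r s := by
    ext m
    exact real_inner_smul_right _ _ _

theorem edgeSum_apply (s : EuclideanSpace ℝ (Set.powersetCard (Fin (k * n)) 2))
    (m : PerfectHypermatching k n) : edgeSum k n s m = inner ℝ (pairIndicator m) s := rfl

theorem edgeSum_permRep (g : Equiv.Perm (Fin (k * n)))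
    (s : EuclideanSpace ℝ (Set.powersetCard (Fin (k * n)) 2)) :
    edgeSum k n (permRep _ _ g s) = permRep _ _ g (edgeSum k n s) := by
  ext m
  rw [edgeSum_apply, permRep_apply, edgeSum_apply, ← inner_permRep g (pairIndicator (g⁻¹ • m)),
    permRep_pairIndicator, smul_inv_smul]

theorem inner_edgeSum (hk : 2 ≤ k) (hn : 2 ≤ n)
    (v : EuclideanSpace ℝ (Set.powersetCard (Fin (k * n)) 2))
    {s : EuclideanSpace ℝ (Set.powersetCard (Fin (k * n)) 2)}
    (hs : s ∈ (specht (k * n)).toSubmodule) :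
    inner ℝ (edgeSum k n v) (edgeSum k n s) = gramEigenvalue k n * inner ℝ v s := by
  rw [← sum_inner_mul_inner hk hn v hs, PiLp.inner_apply]
  exact Finset.sum_congr rfl fun m _ => mul_comm _ _

theorem gramEigenvalue_pos (hk : 2 ≤ k) (hn : 2 ≤ n) (m : PerfectHypermatching k n) :
    0 < gramEigenvalue k n := by
  have hN := four_le_mul hk hn
  have hk' : (2 : ℝ) ≤ k := by exact_mod_cast hk
  have hn' : (2 : ℝ) ≤ n := by exact_mod_cast hn
  have hc : (0 : ℝ) < Fintype.card (PerfectHypermatching k n) := by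
    exact_mod_cast Fintype.card_pos_iff.2 ⟨m⟩
  unfold gramEigenvalue
  have h1 : (0 : ℝ) < k - 1 := by linarith
  have h2 : (0 : ℝ) < k * n - k := by nlinarith
  have h3 : (0 : ℝ) < k * n - 1 := by linarith
  have h4 : (0 : ℝ) < k * n - 3 := by linarith
  positivity

theorem eq_zero_of_edgeSum_eq_zero (hk : 2 ≤ k) (hn : 2 ≤ n) (m : PerfectHypermatching k n)
    {s : EuclideanSpace ℝ (Set.powersetCard (Fin (k * n)) 2)}
    (hs : s ∈ (specht (k * n)).toSubmodule) (h : edgeSum k n s = 0) : s = 0 := by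
  have h1 := inner_edgeSum hk hn s hs
  rw [h, inner_zero_left] at h1
  exact inner_self_eq_zero.1
    ((mul_eq_zero.1 h1.symm).resolve_left (ne_of_gt (gramEigenvalue_pos hk hn m)))

/-- The restriction of `edgeSum` to the Specht module, as a map of representations. -/
noncomputable def spechtEdgeSum (k n : ℕ) :
    (specht (k * n)).toRepresentation.IntertwiningMap
      (permRep (Equiv.Perm (Fin (k * n))) (PerfectHypermatching k n)) where
  toLinearMap := edgeSum k n ∘ₗ (specht (k * n)).toSubmodule.subtype
  isIntertwining' g := LinearMap.ext fun s => edgeSum_permRep g s.1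

/-- Every map of representations from the Specht module to the functions on the matchings is a
multiple of `edgeSum`. -/
theorem exists_eq_smul_edgeSum (hk : 2 ≤ k) (hn : 2 ≤ n) (m₀ : PerfectHypermatching k n)
    (φ : (specht (k * n)).toRepresentation.IntertwiningMap
      (permRep (Equiv.Perm (Fin (k * n))) (PerfectHypermatching k n))) :
    ∃ t : ℝ, ∀ s : (specht (k * n)).toSubmodule, φ s = t • edgeSum k n s := by
  have hφ : ∀ (g : Equiv.Perm (Fin (k * n))) (s : (specht (k * n)).toSubmodule)
      (m : PerfectHypermatching k n),
      φ ((specht (k * n)).toRepresentation g⁻¹ s) m = φ s (g • m) := by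
    intro g s m
    rw [φ.isIntertwining, permRep_apply, inv_inv]
  -- By transitivity `φ` is determined by evaluation at `m₀`; the Riesz vector `w` of this
  -- functional is fixed by the stabilizer.
  let ℓ : (specht (k * n)).toSubmodule →ₗ[ℝ] ℝ :=
    { toFun := fun s => φ s m₀
      map_add' := fun s t => by rw [map_add]; rfl
      map_smul' := fun r s => by rw [map_smul]; rfl }
  obtain ⟨w, hw⟩ : ∃ w : (specht (k * n)).toSubmodule, ∀ s, inner ℝ w s = φ s m₀ :=
    ⟨(InnerProductSpace.toDual ℝ _).symm (LinearMap.toContinuousLinearMap ℓ),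
      fun s => by rw [InnerProductSpace.toDual_symm_apply]; rfl⟩
  obtain ⟨t, ht⟩ := eq_smul_centredIndicator hk hn m₀ w.2 (by
    intro h hh
    have : (specht (k * n)).toRepresentation h w = w := by
      refine ext_inner_right ℝ fun s => ?_
      rw [hw, ← (MulAction.mem_stabilizer_iff.1 hh : h • m₀ = m₀), ← hφ, ← hw]
      exact permRep_symm_inner h _ _
    exact congrArg Subtype.val this)
  refine ⟨t, fun s => ?_⟩
  ext m
  obtain ⟨g, rfl⟩ := exists_smul_eq (by omega) m₀ m
  rw [← hφ, ← hw, Submodule.coe_inner, ht, real_inner_smul_left,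
    inner_centredIndicator _ (Subtype.prop _)]
  change t * inner ℝ (pairIndicator m₀) (permRep _ _ g⁻¹ s.1) =
    t * inner ℝ (pairIndicator (g • m₀)) s.1
  rw [← permRep_symm_inner, permRep_pairIndicator]

/-- The component is the supremum of the submodules isomorphic to the Specht module. Each is the
image of an intertwiner, hence inside the range of `edgeSum`, and injectivity makes that range one
of them. Irreducibility plays no role. -/
theorem mem_isotypic_iff (hk : 2 ≤ k) (hn : 2 ≤ n) (m₀ : PerfectHypermatching k n)
    (f : EuclideanSpace ℝ (PerfectHypermatching k n)) :
    f ∈ isotypic k n ↔ ∃ s ∈ (specht (k * n)).toSubmodule, edgeSum k n s = f := by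
  let L := Representation.IntertwiningMap.equivLinearMapAsModule _ _ (spechtEdgeSum k n)
  have hL : ∀ s : (specht (k * n)).toSubmodule, L s = edgeSum k n s := fun _ => rfl
  have hiso : isotypicComponent ℝ[Equiv.Perm (Fin (k * n))]
      (permRep (Equiv.Perm (Fin (k * n))) (PerfectHypermatching k n)).asModule
      (specht (k * n)).toRepresentation.asModule = LinearMap.range L := by
    apply le_antisymm
    · refine sSup_le ?_
      rintro M ⟨e⟩ f hf
      let φ := (Representation.IntertwiningMap.equivLinearMapAsModule _ _).symm
        (M.subtype ∘ₗ e.symm.toLinearMap)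
      obtain ⟨t, ht⟩ := exists_eq_smul_edgeSum hk hn m₀ φ
      have h1 := ht (e ⟨f, hf⟩)
      have h2 : φ (e ⟨f, hf⟩) = f := congrArg Subtype.val (e.symm_apply_apply ⟨f, hf⟩)
      rw [h2] at h1
      let s : (specht (k * n)).toSubmodule := e ⟨f, hf⟩
      refine ⟨t • s, ?_⟩
      exact ((edgeSum k n).map_smul t s.1).trans h1.symm
    · have hinj : Function.Injective L := by
        refine (injective_iff_map_eq_zero L).2 fun s hs => ?_
        exact Subtype.ext (eq_zero_of_edgeSum_eq_zero hk hn m₀ (s := s.1) s.2 hs)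
      exact le_sSup ⟨(LinearEquiv.ofInjective L hinj).symm⟩
  have h : f ∈ isotypic k n ↔ f ∈ LinearMap.range L := by
    rw [← hiso]
    rfl
  rw [h]
  constructor
  · rintro ⟨s, hs⟩
    exact ⟨s.1, s.2, hs⟩
  · rintro ⟨s, hs, rfl⟩
    exact ⟨⟨s, hs⟩, rfl⟩

/-- Against `edgeSum s` with `s` in the Specht module, the point mass at `m` gives `⟪pairIndicator
m, s⟫`, and centring does not change this; `inner_edgeSum` gives the same for the right side. -/
theorem E₁_single (hk : 2 ≤ k) (hn : 2 ≤ n) (m : PerfectHypermatching k n) :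
    E₁ k n (EuclideanSpace.single m 1) =
      (gramEigenvalue k n)⁻¹ • edgeSum k n (centredIndicator m) := by
  have hpos := gramEigenvalue_pos hk hn m
  refine Submodule.eq_starProjection_of_mem_of_inner_eq_zero ?_ ?_
  · refine (isotypic k n).smul_mem _ ((mem_isotypic_iff hk hn m _).2 ⟨_, ?_, rfl⟩)
    exact centredIndicator_mem hk hn m
  · intro f hf
    obtain ⟨s, hs, rfl⟩ := (mem_isotypic_iff hk hn m _).1 hf
    rw [inner_sub_left, real_inner_smul_left, inner_edgeSum hk hn _ hs,
      inner_centredIndicator m hs, inv_mul_cancel_left₀ hpos.ne', EuclideanSpace.inner_single_left,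
      edgeSum_apply]
    simp

theorem E₁_single_apply (hk : 2 ≤ k) (hn : 2 ≤ n) (m m' : PerfectHypermatching k n) :
    E₁ k n (EuclideanSpace.single m' 1) m =
      ((k : ℝ) * n - 1) * (k * n - 3) /
          (k * (k - 1) * (n - 1) * Fintype.card (PerfectHypermatching k n)) * (fp m m' : ℝ)
        - ((k : ℝ) - 1) / (Fintype.card (PerfectHypermatching k n) * k * (n - 1)) *
          (((k * n).choose 2 : ℝ) - k * n) := by
  have hN := four_le_mul hk hn
  have hk' : (2 : ℝ) ≤ k := by exact_mod_cast hk
  have hn' : (2 : ℝ) ≤ n := by exact_mod_cast hn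
  have hc : (0 : ℝ) < Fintype.card (PerfectHypermatching k n) := by
    exact_mod_cast Fintype.card_pos_iff.2 ⟨m⟩
  have h0 : (k : ℝ) ≠ 0 := by linarith
  have h1 : (k : ℝ) - 1 ≠ 0 := by linarith
  have h2 : (n : ℝ) - 1 ≠ 0 := by linarith
  have h3 : (k : ℝ) * n - 1 ≠ 0 := by linarith
  have h4 : (k : ℝ) * n - 3 ≠ 0 := by linarith
  have h5 : (k : ℝ) * n - k = k * (n - 1) := by ring
  rw [E₁_single hk hn, PiLp.smul_apply, edgeSum_apply, inner_pairIndicator_centredIndicator,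
    smul_eq_mul, gramEigenvalue, h5, Nat.cast_choose_two]
  push_cast
  field_simp
  ring

theorem charVec_eq_sum (F : Finset (PerfectHypermatching k n)) :
    charVec F = ∑ m' ∈ F, EuclideanSpace.single m' (1 : ℝ) := by
  ext m
  simp [charVec, Finset.sum_apply, Pi.single_apply]

theorem sum_fp (F : Finset (PerfectHypermatching k n)) (m : PerfectHypermatching k n) :
    ∑ m' ∈ F, (fp m m' : ℝ) =
      ∑ e ∈ m.edges, ∑ p ∈ e.powersetCard 2, ((restriction F p).card : ℝ) := by
  classical
  simp only [sum_edges_choose]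
  push_cast
  rw [Finset.sum_comm]
  refine Finset.sum_congr rfl fun e _ => ?_
  rw [Finset.sum_comm]
  refine Finset.sum_congr rfl fun p _ => ?_
  rw [Finset.sum_boole, restriction]

theorem isSpherical_of_eq (hk : 2 ≤ k) (hn : 2 ≤ n) (m₀ : PerfectHypermatching k n) :
    IsSpherical m₀ fun g => 2 * ((k : ℝ) * n - 1) / ((k : ℝ) ^ 2 * (k - 1) * n * (n - 1)) *
      (fp m₀ (g • m₀) : ℝ) - ((k : ℝ) - 1) / (k * (n - 1)) := by
  have hN := four_le_mul hk hn
  have hk' : (2 : ℝ) ≤ k := by exact_mod_cast hk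
  have hn' : (2 : ℝ) ≤ n := by exact_mod_cast hn
  have h0 : (k : ℝ) ≠ 0 := by linarith
  have h1 : (k : ℝ) - 1 ≠ 0 := by linarith
  have h2 : (n : ℝ) - 1 ≠ 0 := by linarith
  have h3 : (k : ℝ) * n - 1 ≠ 0 := by linarith
  have h4 : (n : ℝ) ≠ 0 := by linarith
  refine ⟨fun h hh h' hh' g => ?_, ?_, ?_⟩
  · have : fp m₀ ((h * g * h') • m₀) = fp m₀ (g • m₀) := by
      rw [mul_smul, MulAction.mem_stabilizer_iff.1 hh', mul_smul]
      nth_rewrite 1 [← MulAction.mem_stabilizer_iff.1 hh]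
      rw [fp_smul_smul]
    simp only [this]
  · simp only [one_smul, fp_self]
    field_simp
    ring
  -- The scalar is the reciprocal of the value of `edgeSum k n (centredIndicator m₀)` at `m₀`.
  · refine ⟨(2 * ((k : ℝ) * n - 1) / ((k : ℝ) ^ 2 * (k - 1) * n * (n - 1))) •
      edgeSum k n (centredIndicator m₀), (isotypic k n).smul_mem _
        ((mem_isotypic_iff hk hn m₀ _).2 ⟨_, centredIndicator_mem hk hn m₀, rfl⟩), fun g => ?_⟩
    rw [PiLp.smul_apply, edgeSum_apply, inner_pairIndicator_centredIndicator, smul_eq_mul,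
      fp_comm]
    field_simp

/-- Left invariance of `ω` and injectivity of `edgeSum` force the underlying Specht vector to be
fixed by the stabilizer, hence onto a line; the value at `1` fixes the scalar. -/
theorem IsSpherical.unique (hk : 2 ≤ k) (hn : 2 ≤ n) {m₀ : PerfectHypermatching k n}
    {ω ω' : Equiv.Perm (Fin (k * n)) → ℝ} (hω : IsSpherical m₀ ω) (hω' : IsSpherical m₀ ω') :
    ω = ω' := by
  have key : ∀ ω, IsSpherical m₀ ω → ∃ t : ℝ, ∀ g,
      ω g = t * edgeSum k n (centredIndicator m₀) (g • m₀) := by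
    rintro ω ⟨hH, -, f, hf, hωf⟩
    obtain ⟨s, hs, rfl⟩ := (mem_isotypic_iff hk hn m₀ _).1 hf
    obtain ⟨t, rfl⟩ := eq_smul_centredIndicator hk hn m₀ hs (by
      intro h hh
      refine sub_eq_zero.1 (eq_zero_of_edgeSum_eq_zero hk hn m₀
        (Submodule.sub_mem _ ((specht (k * n)).apply_mem_toSubmodule h hs) hs) ?_)
      rw [map_sub, sub_eq_zero, edgeSum_permRep]
      ext m
      obtain ⟨g, rfl⟩ := exists_smul_eq (by omega) m₀ m
      rw [permRep_apply, ← mul_smul, ← hωf, ← hωf]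
      simpa using hH h⁻¹ (inv_mem hh) 1 (one_mem _) g)
    exact ⟨t, fun g => by rw [hωf, map_smul]; rfl⟩
  obtain ⟨t, ht⟩ := key ω hω
  obtain ⟨t', ht'⟩ := key ω' hω'
  have h1 := hω.2.1
  have h1' := hω'.2.1
  rw [ht] at h1
  rw [ht'] at h1'
  have : t = t' := mul_right_cancel₀ (right_ne_zero_of_mul_eq_one h1) (h1.trans h1'.symm)
  funext g
  rw [ht, ht', this]

end Isotypic

end Hypermatching

theorem mainTheorem2 (k n : ℕ) (hk : 2 ≤ k) (hn : 2 ≤ n) :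
    (∀ (m₀ : Hypermatching.PerfectHypermatching k n) (ω : Equiv.Perm (Fin (k * n)) → ℝ),
      Hypermatching.IsSpherical m₀ ω ↔
        ∀ g : Equiv.Perm (Fin (k * n)),
          ω g = 2 * ((k : ℝ) * n - 1) / ((k : ℝ) ^ 2 * (k - 1) * n * (n - 1)) *
              (Hypermatching.fp m₀ (g • m₀) : ℝ)
            - ((k : ℝ) - 1) / (k * (n - 1))) ∧
    (∀ m m' : Hypermatching.PerfectHypermatching k n,
      Hypermatching.E₁ k n (EuclideanSpace.single m' 1) m =
        ((k : ℝ) * n - 1) * (k * n - 3) /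
            (k * (k - 1) * (n - 1) * Fintype.card (Hypermatching.PerfectHypermatching k n)) *
            (Hypermatching.fp m m' : ℝ)
          - ((k : ℝ) - 1) /
              (Fintype.card (Hypermatching.PerfectHypermatching k n) * k * (n - 1)) *
            (((k * n).choose 2 : ℝ) - k * n)) ∧
    (∀ (F : Finset (Hypermatching.PerfectHypermatching k n))
        (m : Hypermatching.PerfectHypermatching k n),
      Hypermatching.E₁ k n (Hypermatching.charVec F) m =
        ((k : ℝ) * n - 1) * (k * n - 3) /
            (k * (k - 1) * (n - 1) * Fintype.card (Hypermatching.PerfectHypermatching k n)) *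
            (∑ e ∈ m.edges, ∑ p ∈ e.powersetCard 2,
              ((Hypermatching.restriction F p).card : ℝ))
          - (F.card : ℝ) * (k - 1) /
              (Fintype.card (Hypermatching.PerfectHypermatching k n) * k * (n - 1)) *
            (((k * n).choose 2 : ℝ) - k * n)) := by
  refine ⟨fun m₀ ω => ⟨fun h g => ?_, fun h => ?_⟩,
    Hypermatching.E₁_single_apply hk hn, fun F m => ?_⟩
  · rw [h.unique hk hn (Hypermatching.isSpherical_of_eq hk hn m₀)]
  · rw [funext h]
    exact Hypermatching.isSpherical_of_eq hk hn m₀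
  · rw [Hypermatching.charVec_eq_sum, map_sum, ← Hypermatching.sum_fp]
    simp only [WithLp.ofLp_sum, Finset.sum_apply, Hypermatching.E₁_single_apply hk hn,
      Finset.sum_sub_distrib, ← Finset.mul_sum, Finset.sum_const, nsmul_eq_mul]
    ring
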